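/- All graphs are finite and simple. For graphs $G,H$ and an integer $r\ge 2$ write $G\to_r H$ if every colouring of the edges of $G$ with $r$ colours contains a monochromatic (not necessarily induced) copy of $H$. For an integer $t\ge 0$, the blowup $H[t]$ is obtained from $H$ by replacing every vertex by an independent set of size $t$ and every edge by a complete bipartite graph $K_{t,t}$ between the corresponding sets. A copy of $H[t]$ in $G[n]$ is canonical if it is the $t$-blowup of a copy of $H$ in $G$. If $G\to_r H$, the blowup Ramsey number $B(G\to_r H;t)$ is the least $n$ such that every $r$-colouring of the edges of $G[n]$ contains a monochromatic canonical copy of $H[t]$. Theorem. Let $r\ge 2$ be an integer. (1) For every graph $H$ there is a constant $b=b(H,r)>0$ such that for every graph $G$ with $G\to_r H$ there is a constant $a=a(G,H,r)>0$ such that for every integer $t\ge 0$ the number $B(G\to_r H;t)$ exists (is finite) and $$B(G\to_r H;t)\le a\cdot b^t .$$ (2) There is $\gamma_0=\gamma_0(r)>0$ such that for all $0<\gamma<\gamma_0$ and all graphs $G,H$ with $G\to_r H$ there is $a_0=a_0(G,H,r,\gamma)$ such that for all $a\ge a_0$ and all integers $t\ge 0$, $$B(G\to_r H;t)\le a\cdot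 b^t,\qquad\text{where } b=\begin{cases} r^{(r+\gamma)^{|E(H)|-1}} & \text{if } |E(H)|\ne 1,\\ r^{1+\gamma} & \text{if } |E(H)|=1.\end{cases}$$ -/

import Mathlib

universe u v

namespace BlowupRamsey

open SimpleGraph

/-- `G →_r H`: every colouring of the edges of `G` with `r` colours contains a monochromatic
copy of `H` (a not necessarily induced copy of `H` in one of the colour classes). -/
def Arrow {V : Type v} {W : Type u} (r : ℕ) (G : SimpleGraph V) (H : SimpleGraph W) : Prop :=
  ∀ C : G.EdgeLabeling (Fin r), ∃ i : Fin r, H.IsContained (C.labelGraph i)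

/-- The `n`-blowup `G[n]`: every vertex `v` becomes the independent set `{v} × Fin n`, and every
edge `vw` becomes the complete bipartite graph between the parts of `v` and `w`. -/
def blowup {V : Type v} (G : SimpleGraph V) (n : ℕ) : SimpleGraph (V × Fin n) :=
  G.comap Prod.fst

/-- Every colouring of the edges of `G[n]` with `r` colours contains a monochromatic canonical copy
of `H[t]`. A copy of `H[t]` in `G[n]` is canonical if it is the blowup of a copy `f` of `H` in `G`,
that is, if it sends the part of each vertex `w` of `H` into the part of `f w`. -/
def CanonicalArrow {V : Type v} {W : Type u} (r : ℕ) (G : SimpleGraph V) (n : ℕ)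
    (H : SimpleGraph W) (t : ℕ) : Prop :=
  ∀ C : (blowup G n).EdgeLabeling (Fin r), ∃ (i : Fin r)
    (φ : Copy (blowup H t) (C.labelGraph i)) (f : Copy H G),
    ∀ x : W × Fin t, (φ x).1 = f x.1

/-- The blowup Ramsey number `B(G →_r H; t)`: the least `n` such that every `r`-colouring of `G[n]`
contains a monochromatic canonical copy of `H[t]` (with value `0` if there is no such `n`). -/
noncomputable def blowupRamseyNumber {V : Type v} {W : Type u} (r : ℕ) (G : SimpleGraph V)
    (H : SimpleGraph W) (t : ℕ) : ℕ :=
  sInf {n : ℕ | CanonicalArrow r G n H t}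

end BlowupRamsey

namespace BlowupRamsey

open SimpleGraph Finset Filter Topology

/-! Let `e = |E(H)| ≥ 1` and colour `G[n]`. In the most popular colour, each edge of `G` spans a
pair of density at least `1/r`. Treating the edges one by one, pass to subsets of the parts, of size
a constant fraction of `n`, on which every edge of `G` has a colour in which its pair is
lower-regular with density `p` slightly below `1/r`. These colours form an `r`-colouring of `G`, so
`G →_r H` yields a copy of `H` whose pairs are all lower-regular in one colour
(`exists_lowerRegular_copy`).

A blowup of `H` is then grown inside these parts, one vertex of `H` at a time. Suppose `m` disjoint
transversals have been placed. For a new vertex with `d` neighbours already placed, regularity gives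
each transversal nearly a `p ^ d` fraction of the part as candidates, so about `p ^ d * m` of the
transversals share a large candidate set (`exists_large_common`). Keeping only those costs a factor
`p ^ d`. One edge is free: the first vertex starts with a constant multiple of `m₀` transversals,
and exactly `m₀` survive the second, its neighbour, provided `n` is about `r ^ m₀`. Hence about `p ^
(e - 1) * m₀` transversals remain (`exists_isPartialBlowup_univ`), and `m₀ ≈ r ^ (e - 1) * t`
suffices for `H[t]`. This gives base `r ^ (r ^ (e - 1))` up to a small loss; `G` affects only the
multiplicative constant. -/

open scoped Classical in
/-- The number of ordered pairs in `X × Y` that are adjacent in `K`, as a real number. -/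
noncomputable def edgeSum {Ω : Type*} (K : SimpleGraph Ω) (X Y : Finset Ω) : ℝ :=
  ∑ x ∈ X, ∑ y ∈ Y, if K.Adj x y then 1 else 0

/-- Every pair of subsets of `A` and `B` of relative size at least `ε` has density at least `p`. -/
def LowerRegular {Ω : Type*} (ε p : ℝ) (K : SimpleGraph Ω) (A B : Finset Ω) : Prop :=
  ∀ X ⊆ A, ∀ Y ⊆ B, ε * #A ≤ #X → ε * #B ≤ #Y → p * (#X * #Y) ≤ edgeSum K X Y

/-! ### Edge counts and lower-regular pairs. -/

section EdgeSum

variable {Ω : Type*} (K : SimpleGraph Ω)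

lemma edgeSum_comm (X Y : Finset Ω) : edgeSum K X Y = edgeSum K Y X := by
  classical
  unfold edgeSum
  rw [sum_comm]
  exact sum_congr rfl fun y _ => sum_congr rfl fun x _ => if_congr (K.adj_comm x y) rfl rfl

lemma edgeSum_le (X Y : Finset Ω) : edgeSum K X Y ≤ #X * #Y := by
  classical
  calc edgeSum K X Y ≤ ∑ x ∈ X, ∑ y ∈ Y, (1 : ℝ) :=
        sum_le_sum fun _ _ => sum_le_sum fun _ _ => by split_ifs <;> norm_num
    _ = _ := by simp

lemma edgeSum_eq_sum_card [DecidableRel K.Adj] (X Y : Finset Ω) :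
    edgeSum K X Y = ∑ x ∈ X, (#{y ∈ Y | K.Adj x y} : ℝ) := by
  unfold edgeSum
  refine sum_congr rfl fun x _ => ?_
  rw [card_filter, Nat.cast_sum]
  refine sum_congr rfl fun y _ => ?_
  by_cases h : K.Adj x y <;> simp [h]

lemma edgeSum_split [DecidableEq Ω] {X Y A B : Finset Ω} (hX : X ⊆ A) (hY : Y ⊆ B) :
    edgeSum K A B = edgeSum K X Y + edgeSum K X (B \ Y) + edgeSum K (A \ X) B := by
  unfold edgeSum
  rw [← sum_sdiff hX, ← sum_add_distrib, add_comm]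
  congr 1
  refine sum_congr rfl fun x _ => ?_
  rw [← sum_sdiff hY, add_comm]

end EdgeSum

lemma LowerRegular.symm {Ω : Type*} {ε p : ℝ} {K : SimpleGraph Ω} {A B : Finset Ω}
    (h : LowerRegular ε p K A B) : LowerRegular ε p K B A := by
  intro X hX Y hY h1 h2
  rw [edgeSum_comm, mul_comm (#X : ℝ)]
  exact h Y hY X hX h2 h1

lemma LowerRegular.mono {Ω : Type*} {ε δ p : ℝ} {K : SimpleGraph Ω} {A B A' B' : Finset Ω}
    (hε : 0 ≤ ε) (h : LowerRegular (ε * δ) p K A B) (hA : A' ⊆ A) (hB : B' ⊆ B)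
    (hA' : δ * #A ≤ #A') (hB' : δ * #B ≤ #B') : LowerRegular ε p K A' B' := by
  intro X hX Y hY h1 h2
  refine h X (hX.trans hA) Y (hY.trans hB) ?_ ?_
  · rw [mul_assoc]; exact (mul_le_mul_of_nonneg_left hA' hε).trans h1
  · rw [mul_assoc]; exact (mul_le_mul_of_nonneg_left hB' hε).trans h2

/-- A dense pair contains a lower-regular pair of linear size. -/
lemma exists_lowerRegular {p d ε : ℝ} (hp : 0 ≤ p) (hpd : p < d) (hd : d ≤ 1) (hε : 0 < ε)
    (hε1 : ε ≤ 1) :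
    ∃ δ : ℝ, 0 < δ ∧ δ ≤ 1 ∧ ∀ {Ω : Type*} (K : SimpleGraph Ω) (A B : Finset Ω),
      A.Nonempty → B.Nonempty → d * (#A * #B) ≤ edgeSum K A B →
      ∃ A' ⊆ A, ∃ B' ⊆ B, δ * #A ≤ #A' ∧ δ * #B ≤ #B' ∧ LowerRegular ε p K A' B' := by
  have hd0 : 0 < d := hp.trans_lt hpd
  -- With this value, the loss `2 * η` from two rectangles is only half of the deficit `(d - p) * ε
  -- ^ 2` created by a sparse subpair.
  obtain ⟨η, hη⟩ : ∃ η, η = (d - p) * ε ^ 2 / 4 := ⟨_, rfl⟩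
  have hη0 : 0 < η := by rw [hη]; have := sub_pos.2 hpd; positivity
  have hη1 : η < 1 := by
    have : ε ^ 2 ≤ 1 := pow_le_one₀ hε.le hε1
    have : (d - p) * ε ^ 2 ≤ 1 * 1 := by gcongr; linarith
    rw [hη]; linarith
  refine ⟨d ^ (1 / η), by positivity, Real.rpow_le_one hd0.le hd (by positivity), ?_⟩
  intro Ω K A B hA hB hAB
  classical
  -- Extremal choice: maximise density times area to the power `η`. Comparison with `(A, B)` forces
  -- the maximiser to be dense and large, whereas comparison with its subpairs bounds their edge
  -- counts.
  set F : Finset Ω × Finset Ω → ℝ :=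
    fun q => edgeSum K q.1 q.2 * ((#q.1 : ℝ) * #q.2) ^ (η - 1) with hF
  obtain ⟨⟨A', B'⟩, hmem, hmax⟩ := exists_max_image (A.powerset ×ˢ B.powerset) F
    ⟨(A, B), by simp⟩
  simp only [mem_product, mem_powerset] at hmem
  obtain ⟨hA', hB'⟩ := hmem
  have ha : (0 : ℝ) < #A := by exact_mod_cast hA.card_pos
  have hb : (0 : ℝ) < #B := by exact_mod_cast hB.card_pos
  set N : ℝ := (#A' : ℝ) * #B' with hN
  set E := edgeSum K A' B' with hE
  have hEN : E ≤ N := edgeSum_le K A' B'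
  have hN0' : 0 ≤ N := by positivity
  have hpow : ∀ x : ℝ, 0 < x → x * x ^ (η - 1) = x ^ η := by
    intro x hx
    rw [Real.rpow_sub_one hx.ne']; field_simp
  have h1 : d * ((#A : ℝ) * #B) ^ η ≤ E * N ^ (η - 1) := by
    have := hmax (A, B) (by simp)
    refine le_trans ?_ this
    simp only [hF]
    rw [← hpow _ (by positivity), ← mul_assoc]
    gcongr
  have hE0 : 0 < E := by
    have : 0 < E * N ^ (η - 1) := lt_of_lt_of_le (by positivity) h1
    exact pos_of_mul_pos_left this (by positivity)
  have hN0 : 0 < N := hE0.trans_le hEN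
  have hNle : N ≤ (#A : ℝ) * #B := by
    rw [hN]; gcongr
  have hEd : d * N ≤ E := by
    have h2 : d * N ^ η ≤ E * N ^ (η - 1) := le_trans (by gcongr) h1
    rw [← hpow N hN0, ← mul_assoc] at h2
    exact le_of_mul_le_mul_right h2 (by positivity)
  have hsize : d ^ (1 / η) * ((#A : ℝ) * #B) ≤ N := by
    have h2 : d * ((#A : ℝ) * #B) ^ η ≤ N ^ η := by
      refine h1.trans ?_
      rw [← hpow N hN0]; gcongr
    have h3 := Real.rpow_le_rpow (by positivity) h2 (by positivity : 0 ≤ 1 / η)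
    rw [Real.mul_rpow hd0.le (by positivity), ← Real.rpow_mul (by positivity),
      ← Real.rpow_mul hN0', mul_one_div_cancel hη0.ne', Real.rpow_one, Real.rpow_one] at h3
    exact h3
  have hsub : ∀ S ⊆ A', ∀ T ⊆ B', edgeSum K S T ≤ E * ((#S : ℝ) * #T / N + η) := by
    intro S hS T hT
    set M : ℝ := (#S : ℝ) * #T with hM
    rcases (by positivity : 0 ≤ M).eq_or_lt with h0 | hM0
    · have := edgeSum_le K S T
      rw [← hM, ← h0] at this
      refine this.trans ?_
      positivity
    have h2 := hmax (S, T) (by simp [hS.trans hA', hT.trans hB'])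
    simp only [hF] at h2
    rw [← hM, ← hN, ← hE] at h2
    have h3 : edgeSum K S T ≤ E * (M / N) ^ (1 - η) := by
      have : M ^ (η - 1) * M ^ (1 - η) = 1 := by
        rw [← Real.rpow_add hM0]; simp
      have h4 : N ^ (η - 1) = (N ^ (1 - η))⁻¹ := by
        rw [← Real.rpow_neg hN0']; congr 1; ring
      calc edgeSum K S T = edgeSum K S T * M ^ (η - 1) * M ^ (1 - η) := by
            rw [mul_assoc, this, mul_one]
        _ ≤ E * N ^ (η - 1) * M ^ (1 - η) := by gcongr
        _ = _ := by rw [Real.div_rpow hM0.le hN0', h4]; field_simp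
    refine h3.trans (mul_le_mul_of_nonneg_left ?_ hE0.le)
    -- Linearises `(M / N) ^ (1 - η)` to at most `M / N + η`, so that bounds for disjoint rectangles
    -- can be added.
    have h5 := Real.geom_mean_le_arith_mean2_weighted (sub_nonneg.2 hη1.le) hη0.le
      (by positivity : 0 ≤ M / N) zero_le_one (by ring)
    rw [Real.one_rpow, mul_one, mul_one] at h5
    have : 0 ≤ η * (M / N) := by positivity
    linarith
  refine ⟨A', hA', B', hB', ?_, ?_, ?_⟩
  · have : N ≤ #A' * #B := by rw [hN]; gcongr
    have := hsize.trans this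
    rw [← mul_assoc] at this
    exact le_of_mul_le_mul_right this hb
  · have : N ≤ #A * #B' := by rw [hN]; gcongr
    have := hsize.trans this
    rw [mul_left_comm] at this
    exact le_of_mul_le_mul_left this ha
  · intro X hX Y hY hXε hYε
    by_contra! hlt
    set P : ℝ := (#X : ℝ) * #Y with hP
    have hs := edgeSum_split K hX hY
    have hu := hsub X hX (B' \ Y) sdiff_subset
    have hv := hsub (A' \ X) sdiff_subset B' subset_rfl
    -- Outside `X × Y`, the product `A' × B'` splits into two rectangles of total area `N - P`. They
    -- cannot hold enough edges to compensate for a sparse `X × Y`.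
    have hsum : (#X : ℝ) * #(B' \ Y) + #(A' \ X) * #B' = N - P := by
      rw [cast_card_sdiff hX, cast_card_sdiff hY]
      ring
    have h6 : E < p * P + E * ((N - P) / N + 2 * η) := by
      rw [← hsum, add_div]
      linarith
    have h7 : E * P < p * P * N + 2 * E * η * N := by
      have := mul_lt_mul_of_pos_right h6 hN0
      have e1 : (p * P + E * ((N - P) / N + 2 * η)) * N
          = p * P * N + E * (N - P) + 2 * E * η * N := by field_simp; ring
      rw [e1] at this
      linarith
    have hPN : ε ^ 2 * N ≤ P := by
      calc ε ^ 2 * N = (ε * #A') * (ε * #B') := by rw [hN]; ring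
        _ ≤ P := by rw [hP]; gcongr
    have h8 : (d - p) * E ≤ E - p * N := by
      have : (d - p) * E ≤ (d - p) * N := mul_le_mul_of_nonneg_left hEN (by linarith)
      linarith
    have h9 : ((d - p) * E) * (ε ^ 2 * N) ≤ (E - p * N) * P := by
      gcongr
      exact le_trans (mul_nonneg (by linarith) hE0.le) h8
    have h10 : ((d - p) * E) * (ε ^ 2 * N) = 4 * η * E * N := by rw [hη]; ring
    have h11 : 0 < η * E * N := by positivity
    have h12 : (E - p * N) * P = E * P - p * P * N := by ring
    linarith

/-! ### Regularising all edges of `G` and applying the Ramsey hypothesis. -/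

lemma exists_popular_colour {Ω : Type*} {r : ℕ} (hr : 0 < r) (K : Fin r → SimpleGraph Ω)
    {A B : Finset Ω} (h : ∀ x ∈ A, ∀ y ∈ B, ∃ i, (K i).Adj x y) :
    ∃ i, (1 / r : ℝ) * (#A * #B) ≤ edgeSum (K i) A B := by
  classical
  have : Nonempty (Fin r) := ⟨⟨0, hr⟩⟩
  have hsum : (#A * #B : ℝ) ≤ ∑ i, edgeSum (K i) A B := by
    unfold edgeSum
    rw [sum_comm]
    calc (#A * #B : ℝ) = ∑ x ∈ A, ∑ y ∈ B, (1 : ℝ) := by simp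
      _ ≤ ∑ x ∈ A, ∑ i, ∑ y ∈ B, if (K i).Adj x y then 1 else 0 := by
        refine sum_le_sum fun x hx => ?_
        rw [sum_comm]
        refine sum_le_sum fun y hy => ?_
        obtain ⟨i, hi⟩ := h x hx y hy
        refine le_trans ?_ (single_le_sum (fun j _ => ?_) (mem_univ i))
        · simp [hi]
        · split_ifs <;> norm_num
  obtain ⟨i, -, hi⟩ := exists_le_of_sum_le (s := univ) univ_nonempty
    (f := fun _ : Fin r => (1 / r : ℝ) * (#A * #B)) (g := fun i => edgeSum (K i) A B) (by
      have : (r : ℝ) ≠ 0 := by positivity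
      simp only [sum_const, card_univ, Fintype.card_fin, nsmul_eq_mul]
      rw [← mul_assoc, mul_one_div_cancel this, one_mul]
      exact hsum)
  exact ⟨i, hi⟩

lemma exists_lowerRegular_family {V : Type*} (G : SimpleGraph V) {r : ℕ} (hr : 0 < r) {p : ℝ}
    (hp : 0 ≤ p) (hpr : p < 1 / r) (l : Finset (Sym2 V)) (hl : (l : Set (Sym2 V)) ⊆ G.edgeSet) :
    ∀ {ε : ℝ}, 0 < ε → ε ≤ 1 →
    ∃ δ : ℝ, 0 < δ ∧ δ ≤ 1 ∧ ∀ {Ω : Type*} (K : Fin r → SimpleGraph Ω) (A : V → Finset Ω),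
      (∀ v, (A v).Nonempty) →
      (∀ v w, G.Adj v w → ∀ x ∈ A v, ∀ y ∈ A w, ∃ i, (K i).Adj x y) →
      ∃ A' : V → Finset Ω, (∀ v, A' v ⊆ A v) ∧ (∀ v, δ * #(A v) ≤ #(A' v)) ∧
        ∀ e ∈ l, ∃ i, ∀ v w, s(v, w) = e → LowerRegular ε p (K i) (A' v) (A' w) := by
  classical
  induction l using Finset.induction_on with
  | empty =>
    intro ε _ _
    exact ⟨1, one_pos, le_rfl, fun K A _ _ => ⟨A, fun _ => subset_rfl, fun _ => by simp, by simp⟩⟩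
  | insert e l _ ih =>
    intro ε hε hε1
    obtain ⟨δ₁, h1, h1', H1⟩ := ih (fun x hx => hl (by simp at hx ⊢; exact Or.inr hx)) hε hε1
    have hr1 : (1 / r : ℝ) ≤ 1 := by
      rw [div_le_one (by positivity)]; exact_mod_cast hr
    -- The new edge is treated before the others. Precision `ε * δ₁` leaves it `ε`-regular after the
    -- later steps shrink its parts by a factor of at least `δ₁`.
    obtain ⟨δ₂, h2, h2', H2⟩ := exists_lowerRegular hp hpr hr1 (mul_pos hε h1)
      (mul_le_one₀ hε1 h1.le h1')
    refine ⟨δ₁ * δ₂, mul_pos h1 h2, mul_le_one₀ h1' h2.le h2', fun {Ω} K A hA hK => ?_⟩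
    induction e using Sym2.ind with | _ a b => ?_
    have hab : s(a, b) ∈ G.edgeSet := hl (mem_coe.2 (mem_insert_self _ _))
    rw [mem_edgeSet] at hab
    obtain ⟨i, hi⟩ := exists_popular_colour hr K (hK a b hab)
    obtain ⟨Sa, hSa, Sb, hSb, hca, hcb, hreg⟩ := H2 (K i) (A a) (A b) (hA a) (hA b) hi
    obtain ⟨A₁, hA₁⟩ : ∃ A₁, A₁ = Function.update (Function.update A a Sa) b Sb := ⟨_, rfl⟩
    have ha : A₁ a = Sa := by simp [hA₁, hab.ne]
    have hb : A₁ b = Sb := by simp [hA₁]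
    have hsub : ∀ v, A₁ v ⊆ A v := by
      intro v
      by_cases hvb : v = b
      · subst hvb; rwa [hb]
      by_cases hva : v = a
      · subst hva; rwa [ha]
      simp [hA₁, hva, hvb]
    have hcard : ∀ v, δ₂ * #(A v) ≤ #(A₁ v) := by
      intro v
      by_cases hvb : v = b
      · subst hvb; rwa [hb]
      by_cases hva : v = a
      · subst hva; rwa [ha]
      simp only [hA₁, Function.update_of_ne hvb, Function.update_of_ne hva]
      exact mul_le_of_le_one_left (by positivity) h2'
    have hne : ∀ v, (A₁ v).Nonempty := by
      intro v
      have : (0 : ℝ) < #(A v) := by exact_mod_cast (hA v).card_pos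
      have : (0 : ℝ) < #(A₁ v) := lt_of_lt_of_le (by positivity) (hcard v)
      exact card_pos.1 (by exact_mod_cast this)
    obtain ⟨A', hA', hc', hreg'⟩ := H1 K A₁ hne
      fun v w hvw x hx y hy => hK v w hvw x (hsub v hx) y (hsub w hy)
    refine ⟨A', fun v => (hA' v).trans (hsub v), fun v => ?_, ?_⟩
    · rw [mul_assoc]
      exact (mul_le_mul_of_nonneg_left (hcard v) h1.le).trans (hc' v)
    · intro e he
      rw [mem_insert] at he
      rcases he with rfl | he
      · have key : LowerRegular ε p (K i) (A' a) (A' b) :=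
          LowerRegular.mono hε.le hreg (ha ▸ hA' a) (hb ▸ hA' b) (ha ▸ hc' a) (hb ▸ hc' b)
        refine ⟨i, fun v w hvw => ?_⟩
        rw [Sym2.eq_iff] at hvw
        rcases hvw with ⟨rfl, rfl⟩ | ⟨rfl, rfl⟩
        · exact key
        · exact key.symm
      · exact hreg' e he

/-- If `G →_r H`, then every `r`-colouring of a blowup of `G` contains parts of linear size that
are indexed by a copy of `H` in `G` and are lower-regular in a common colour along its edges. -/
lemma exists_lowerRegular_copy {V : Type*} [Finite V] {W : Type*} {G : SimpleGraph V}
    {H : SimpleGraph W} {r : ℕ} (hr : 0 < r) (hGH : Arrow r G H) {p ε : ℝ}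
    (hp : 0 ≤ p) (hpr : p < 1 / r) (hε : 0 < ε) (hε1 : ε ≤ 1) :
    ∃ δ : ℝ, 0 < δ ∧ δ ≤ 1 ∧ ∀ {Ω : Type*} (K : Fin r → SimpleGraph Ω) (A : V → Finset Ω),
      (∀ v, (A v).Nonempty) →
      (∀ v w, G.Adj v w → ∀ x ∈ A v, ∀ y ∈ A w, ∃ i, (K i).Adj x y) →
      ∃ (A' : V → Finset Ω) (i : Fin r) (f : Copy H G), (∀ v, A' v ⊆ A v) ∧
        (∀ v, δ * #(A v) ≤ #(A' v)) ∧
        ∀ u w, H.Adj u w → LowerRegular ε p (K i) (A' (f u)) (A' (f w)) := by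
  classical
  have := Fintype.ofFinite V
  obtain ⟨δ, h0, h1, h⟩ := exists_lowerRegular_family G hr hp hpr G.edgeFinset (by simp) hε hε1
  refine ⟨δ, h0, h1, fun {Ω} K A hA hK => ?_⟩
  obtain ⟨A', hA', hc, hreg⟩ := h K A hA hK
  have : Nonempty (Fin r) := ⟨⟨0, hr⟩⟩
  choose! c hcol using hreg
  -- Each edge of `G` is coloured by a colour in which its pair is lower-regular.
  obtain ⟨C, hC⟩ : ∃ C : G.EdgeLabeling (Fin r), ∀ e, C e = c e := ⟨fun e => c e, fun _ => rfl⟩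
  obtain ⟨i, ⟨g⟩⟩ := hGH C
  refine ⟨A', i, ⟨(Hom.ofLE C.labelGraph_le).comp g.toHom, g.injective'⟩, hA', hc,
    fun u w huw => ?_⟩
  obtain ⟨h3, h4⟩ := (EdgeLabeling.labelGraph_adj _ _).1 (g.toHom.map_adj huw)
  have := hcol s(g.toHom u, g.toHom w) (by simpa using h3) _ _ rfl
  rw [show c s(g.toHom u, g.toHom w) = i from (hC _).symm.trans h4] at this
  exact this

/-! ### Common intersections by averaging. -/

/-- If each of `m` subsets of `B` has relative size at least `c`, then some `s` of them have a
large common intersection. -/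
lemma exists_large_common {Ω : Type*} {m s D : ℕ} {c ε : ℝ} {B : Finset Ω}
    (E : Fin m → Finset Ω) (hEB : ∀ j, E j ⊆ B) (hE : ∀ j, c * #B ≤ #(E j)) (hεc : ε ≤ c)
    (hsm : s ≤ m) (hm : 0 < m) (hD : (D : ℝ) < (c - ε) * m + 1) :
    ∃ (S : Finset (Fin m)) (Y : Finset Ω), #S = s ∧ (∀ j ∈ S, Y ⊆ E j) ∧
      ε * #B * D.choose s ≤ #Y * m.choose s := by
  classical
  set N : Ω → Finset (Fin m) := fun y => {j | y ∈ E j} with hN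
  have hNm : ∀ y, #(N y) ≤ m := fun y => (card_le_univ _).trans (by simp)
  set T : Finset Ω := {y ∈ B | D ≤ #(N y)} with hT
  have hm' : (0 : ℝ) < m := by exact_mod_cast hm
  have hcount : ∑ j, (#(E j) : ℝ) = ∑ y ∈ B, (#(N y) : ℝ) := by
    have h := sum_card_bipartiteAbove_eq_sum_card_bipartiteBelow (s := (univ : Finset (Fin m)))
      (t := B) (fun j y => y ∈ E j)
    have h1 : ∀ j, bipartiteAbove (fun j y => y ∈ E j) B j = E j := fun j => by
      ext y; simp only [mem_bipartiteAbove]; exact ⟨fun h => h.2, fun h => ⟨hEB j h, h⟩⟩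
    have h2 : ∀ y, bipartiteBelow (fun j y => y ∈ E j) (univ : Finset (Fin m)) y = N y :=
      fun y => by ext j; simp [hN]
    simp only [h1, h2] at h
    exact_mod_cast h
  -- The average multiplicity is at least `c * m`. Points outside `T` have multiplicity at most `D -
  -- 1 < (c - ε) * m`, so a fraction `ε` of `B` must lie in `T`.
  have hTcard : ε * #B ≤ #T := by
    have h1 : c * #B * m ≤ ∑ y ∈ B, (#(N y) : ℝ) := by
      rw [← hcount]
      calc c * #B * m = ∑ _j : Fin m, c * (#B : ℝ) := by simp [mul_comm]
        _ ≤ _ := sum_le_sum fun j _ => hE j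
    have h2 : ∑ y ∈ B, (#(N y) : ℝ) ≤
        ∑ y ∈ B, ((c - ε) * m + if D ≤ #(N y) then (m : ℝ) else 0) := by
      refine sum_le_sum fun y _ => ?_
      split_ifs with h
      · have : (#(N y) : ℝ) ≤ m := by exact_mod_cast hNm y
        have : 0 ≤ (c - ε) * m := mul_nonneg (by linarith) hm'.le
        linarith
      · have : (#(N y) : ℝ) + 1 ≤ D := by exact_mod_cast (by omega : #(N y) + 1 ≤ D)
        linarith
    rw [sum_add_distrib, ← sum_filter] at h2
    simp only [sum_const, nsmul_eq_mul] at h2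
    refine le_of_mul_le_mul_right ?_ hm'
    rw [← hT] at h2
    linarith
  -- Double count pairs `(S, y)` with `y` in every set indexed by `S`: each point of `T` lies in at
  -- least `D.choose s` of them.
  have hdouble : (#T : ℝ) * D.choose s ≤
      ∑ S ∈ powersetCard s (univ : Finset (Fin m)), (#{y ∈ B | ∀ j ∈ S, y ∈ E j} : ℝ) := by
    have h := sum_card_bipartiteAbove_eq_sum_card_bipartiteBelow
      (s := powersetCard s (univ : Finset (Fin m))) (t := B) (fun S y => ∀ j ∈ S, y ∈ E j)
    have h2 : ∀ y, bipartiteBelow (fun S y => ∀ j ∈ S, y ∈ E j)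
        (powersetCard s (univ : Finset (Fin m))) y = powersetCard s (N y) := fun y => by
      ext S
      simp only [mem_bipartiteBelow, mem_powersetCard, hN, subset_iff, mem_filter, mem_univ]
      exact ⟨fun h => ⟨fun j hj => ⟨trivial, h.2 j hj⟩, h.1.2⟩,
        fun h => ⟨⟨fun _ _ => trivial, h.2⟩, fun j hj => (h.1 hj).2⟩⟩
    simp only [h2, card_powersetCard, bipartiteAbove] at h
    have h3 : #T * D.choose s ≤ ∑ y ∈ B, (#(N y)).choose s := by
      calc #T * D.choose s = ∑ y ∈ T, D.choose s := by simp
        _ ≤ ∑ y ∈ T, (#(N y)).choose s :=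
          sum_le_sum fun y hy => Nat.choose_le_choose s (mem_filter.1 hy).2
        _ ≤ _ := sum_le_sum_of_subset (filter_subset _ _)
    rw [← h] at h3
    exact_mod_cast h3
  by_contra! hcon
  have hlt : ∑ S ∈ powersetCard s (univ : Finset (Fin m)),
      (#{y ∈ B | ∀ j ∈ S, y ∈ E j} : ℝ) * m.choose s <
      ∑ S ∈ powersetCard s (univ : Finset (Fin m)), ε * #B * D.choose s := by
    refine sum_lt_sum_of_nonempty (powersetCard_nonempty.2 (by simpa using hsm)) fun S hS => ?_
    exact hcon S _ (mem_powersetCard.1 hS).2 fun j hj y hy => (mem_filter.1 hy).2 j hj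
  rw [← sum_mul, sum_const, card_powersetCard, card_univ, Fintype.card_fin, nsmul_eq_mul,
    mul_comm] at hlt
  have := lt_of_mul_lt_mul_left hlt (by positivity)
  have h4 : ε * #B * D.choose s ≤ #T * D.choose s := by gcongr
  linarith

/-! ### Partial blowups and their extension by one vertex. -/

section Embedding

variable {Ω W : Type*} (K : SimpleGraph Ω) (H : SimpleGraph W) (B : W → Finset Ω) (p : ℝ)

open scoped Classical in
/-- The vertices of `B w` that are adjacent to the images under `x` of the neighbours of `w`
in `U`. -/
noncomputable def candidates (U : Finset W) (x : W → Ω) (w : W) : Finset Ω :=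
  {y ∈ B w | ∀ u ∈ U, H.Adj w u → K.Adj y (x u)}

open scoped Classical in
/-- The candidates for the image of `w` that shrink the candidate sets of the neighbours of `w`
outside `U` by a factor of at most `p`. -/
noncomputable def goodCandidates (U : Finset W) (x : W → Ω) (w : W) : Finset Ω :=
  {y ∈ candidates K H B U x w | ∀ w' ∉ insert w U, H.Adj w' w →
    p * #(candidates K H B U x w') ≤ #{z ∈ candidates K H B U x w' | K.Adj z y}}

open scoped Classical in
/-- The number of neighbours of `w` in `U`. -/
noncomputable def degreeInto (U : Finset W) (w : W) : ℕ := #{u ∈ U | H.Adj w u}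

/-- `x` embeds the `m`-blowup of `H[U]` in `K`, with the part of `u` inside `B u`, so that the
`m` transversals `x · j` leave many candidates for each vertex outside `U`. -/
structure IsPartialBlowup (U : Finset W) {m : ℕ} (x : W → Fin m → Ω) : Prop where
  injective : ∀ u ∈ U, Function.Injective (x u)
  mem : ∀ u ∈ U, ∀ j, x u j ∈ B u
  adj : ∀ u ∈ U, ∀ u' ∈ U, H.Adj u u' → ∀ j j', K.Adj (x u j) (x u' j')
  card_candidates : ∀ w ∉ U, ∀ j,
    p ^ degreeInto H U w * #(B w) ≤ #(candidates K H B U (fun u => x u j) w)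

variable {K H B p}

lemma candidates_subset (U : Finset W) (x : W → Ω) (w : W) : candidates K H B U x w ⊆ B w := by
  classical exact filter_subset _ _

lemma goodCandidates_subset (U : Finset W) (x : W → Ω) (w : W) :
    goodCandidates K H B p U x w ⊆ B w := by
  classical exact (filter_subset _ _).trans (candidates_subset U x w)

lemma degreeInto_le [Fintype W] (U : Finset W) (w : W) : degreeInto H U w ≤ Fintype.card W := by
  classical exact card_le_univ _

lemma isPartialBlowup_empty {m : ℕ} (x : W → Fin m → Ω) : IsPartialBlowup K H B p ∅ x where
  injective := by simp
  mem := by simp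
  adj := by simp
  card_candidates w _ j := by simp [candidates, degreeInto]

/-- For each unplaced neighbour `w'`, the candidates that shrink its candidate set too much form a
set of density below `p` to it. Regularity therefore makes this set an at most `ε` fraction of `B
w`; sum over at most `Fintype.card W` such neighbours. -/
lemma card_goodCandidates [Fintype W] {ε : ℝ} (hε : 0 < ε) (hp0 : 0 ≤ p) (hp1 : p ≤ 1)
    (hεp : ε ≤ p ^ Fintype.card W) (hB : ∀ w, (B w).Nonempty)
    (hreg : ∀ u w, H.Adj u w → LowerRegular ε p K (B u) (B w)) {U : Finset W} {x : W → Ω}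
    (hx : ∀ w ∉ U, p ^ degreeInto H U w * #(B w) ≤ #(candidates K H B U x w)) {w : W}
    (hw : w ∉ U) :
    (p ^ degreeInto H U w - Fintype.card W * ε) * #(B w) ≤ #(goodCandidates K H B p U x w) := by
  classical
  set bad : W → Finset Ω := fun w' =>
    {y ∈ B w | (#{z ∈ candidates K H B U x w' | K.Adj z y} : ℝ) < p * #(candidates K H B U x w')}
    with hbad
  set I : Finset W := {w' | w' ∉ insert w U ∧ H.Adj w' w} with hI
  have hbcard : ∀ w' ∈ I, (#(bad w') : ℝ) ≤ ε * #(B w) := by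
    intro w' hw'
    obtain ⟨-, hw'U, hadj⟩ := mem_filter.1 hw'
    by_contra! hlt
    have hw'U' : w' ∉ U := fun h => hw'U (mem_insert_of_mem h)
    have hc : ε * #(B w') ≤ #(candidates K H B U x w') := by
      refine le_trans ?_ (hx w' hw'U')
      gcongr
      exact hεp.trans (pow_le_pow_of_le_one hp0 hp1 (degreeInto_le U w'))
    have h1 := hreg w w' hadj.symm (bad w') (filter_subset _ _) _ (candidates_subset U x w')
      hlt.le hc
    have hne : (bad w').Nonempty := by
      have : (0 : ℝ) < #(bad w') := lt_of_le_of_lt (by positivity) hlt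
      exact card_pos.1 (by exact_mod_cast this)
    rw [edgeSum_eq_sum_card] at h1
    have h2 : ∑ y ∈ bad w', (#{z ∈ candidates K H B U x w' | K.Adj y z} : ℝ) <
        ∑ y ∈ bad w', p * #(candidates K H B U x w') := by
      refine sum_lt_sum_of_nonempty hne fun y hy => ?_
      simp only [K.adj_comm y]
      exact (mem_filter.1 hy).2
    rw [sum_const, nsmul_eq_mul] at h2
    linarith
  have hcov : candidates K H B U x w ⊆ goodCandidates K H B p U x w ∪ I.biUnion bad := by
    intro y hy
    by_cases hg : y ∈ goodCandidates K H B p U x w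
    · exact mem_union_left _ hg
    refine mem_union_right _ ?_
    simp only [goodCandidates, mem_filter, not_and, not_forall, not_le] at hg
    obtain ⟨w', hw', hadj, hlt⟩ := hg hy
    refine mem_biUnion.2 ⟨w', by simpa [hI] using ⟨by simpa using hw', hadj⟩, ?_⟩
    refine mem_filter.2 ⟨candidates_subset U x w hy, ?_⟩
    convert hlt
  have h3 : (#(candidates K H B U x w) : ℝ) ≤ #(goodCandidates K H B p U x w) +
      ∑ w' ∈ I, (#(bad w') : ℝ) := by
    exact_mod_cast (card_le_card hcov).trans ((card_union_le _ _).trans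
      (Nat.add_le_add_left card_biUnion_le _))
  have h4 : ∑ w' ∈ I, (#(bad w') : ℝ) ≤ Fintype.card W * (ε * #(B w)) := by
    refine (sum_le_sum hbcard).trans ?_
    rw [sum_const, nsmul_eq_mul]
    gcongr
    exact card_le_univ _
  have := hx w hw
  linarith

lemma candidates_insert [DecidableEq W] {U : Finset W} {w w' : W} {x x' : W → Ω}
    (hx : ∀ u ∈ U, x' u = x u) (hadj : ¬ H.Adj w' w) :
    candidates K H B (insert w U) x' w' = candidates K H B U x w' := by
  ext y
  simp only [candidates, mem_filter, mem_insert, forall_eq_or_imp, hadj, false_imp_iff, true_and]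
  refine and_congr_right fun _ => forall₂_congr fun u hu => by rw [hx u hu]

lemma candidates_insert_of_adj [DecidableEq W] [DecidableRel K.Adj] {U : Finset W} {w w' : W}
    {x x' : W → Ω}
    (hx : ∀ u ∈ U, x' u = x u) (hadj : H.Adj w' w) :
    candidates K H B (insert w U) x' w' = {z ∈ candidates K H B U x w' | K.Adj z (x' w)} := by
  ext y
  simp only [candidates, mem_filter, mem_insert, forall_eq_or_imp, hadj, true_imp_iff]
  have : (∀ u ∈ U, H.Adj w' u → K.Adj y (x' u)) ↔ ∀ u ∈ U, H.Adj w' u → K.Adj y (x u) :=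
    forall₂_congr fun u hu => by rw [hx u hu]
  rw [this]
  tauto

lemma degreeInto_insert [DecidableEq W] {U : Finset W} {w : W} (hw : w ∉ U) (w' : W)
    [Decidable (H.Adj w' w)] :
    degreeInto H (insert w U) w' = degreeInto H U w' + if H.Adj w' w then 1 else 0 := by
  unfold degreeInto
  split_ifs with h
  · rw [filter_insert, if_pos h, card_insert_of_notMem (by simp [hw])]
  · rw [filter_insert, if_neg h, add_zero]

/-- The surviving transversals are those indexed by `S`, and each receives its own vertex of `Y`.
Since `Y` is good for every `j ∈ S`, the new part is completely joined to the old ones, while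
candidate counts need checking only along each single transversal. -/
lemma IsPartialBlowup.extend [DecidableEq W] {U : Finset W} {m s : ℕ} {x : W → Fin m → Ω}
    (hx : IsPartialBlowup K H B p U x) (hp0 : 0 ≤ p) {w : W} (hw : w ∉ U) {S : Finset (Fin m)}
    (hS : #S = s) {Y : Finset Ω} (hY : s ≤ #Y)
    (hYS : ∀ j ∈ S, Y ⊆ goodCandidates K H B p U (fun u => x u j) w) :
    ∃ x' : W → Fin s → Ω, IsPartialBlowup K H B p (insert w U) x' := by
  classical
  obtain ⟨y⟩ : Nonempty (Fin s ↪ Y) := Function.Embedding.nonempty_of_card_le (by simpa using hY)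
  set g : Fin s → Fin m := fun j => S.orderEmbOfFin hS j with hg
  have hgS : ∀ j, g j ∈ S := fun j => S.orderEmbOfFin_mem hS j
  have hginj : Function.Injective g := (S.orderEmbOfFin hS).injective
  obtain ⟨x', hx'⟩ : ∃ x' : W → Fin s → Ω,
      x' = Function.update (fun u j => x u (g j)) w (fun j => (y j : Ω)) := ⟨_, rfl⟩
  have hw' : ∀ j, x' w j = y j := fun j => by simp [hx']
  have hU : ∀ u ∈ U, ∀ j, x' u j = x u (g j) := fun u hu j => by
    have : u ≠ w := fun h => hw (h ▸ hu)
    simp [hx', this]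
  have hgood : ∀ j j', (y j : Ω) ∈ goodCandidates K H B p U (fun u => x u (g j')) w :=
    fun j j' => hYS _ (hgS j') (y j).2
  have hcand : ∀ j j', ∀ u ∈ U, H.Adj w u → K.Adj (y j : Ω) (x u (g j')) := by
    intro j j'
    exact (mem_filter.1 (mem_filter.1 (hgood j j')).1).2
  refine ⟨x', ?_, ?_, ?_, ?_⟩
  · intro u hu a b hab
    rcases mem_insert.1 hu with rfl | hu
    · rw [hw', hw'] at hab
      exact y.injective (Subtype.ext hab)
    · rw [hU u hu, hU u hu] at hab
      exact hginj (hx.injective u hu hab)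
  · intro u hu j
    rcases mem_insert.1 hu with rfl | hu
    · rw [hw']
      exact goodCandidates_subset _ _ _ (hgood j j)
    · rw [hU u hu]
      exact hx.mem u hu _
  · intro u hu u' hu' hadj j j'
    rcases mem_insert.1 hu with h | h <;> rcases mem_insert.1 hu' with h' | h'
    · exact absurd (h.trans h'.symm) hadj.ne
    · rw [h] at hadj ⊢
      rw [hw', hU u' h']
      exact hcand j j' u' h' hadj
    · rw [h'] at hadj ⊢
      rw [hw', hU u h]
      exact (hcand j' j u h hadj.symm).symm
    · rw [hU u h, hU u' h']
      exact hx.adj u h u' h' hadj _ _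
  · intro w' hw'U j
    have hw'U' : w' ∉ U := fun h => hw'U (mem_insert_of_mem h)
    have h1 := hx.card_candidates w' hw'U' (g j)
    by_cases hadj : H.Adj w' w
    · rw [degreeInto_insert hw, if_pos hadj, candidates_insert_of_adj
        (x := fun u => x u (g j)) (fun u hu => hU u hu j) hadj, hw', pow_succ']
      have h2 := (mem_filter.1 (hgood j j)).2 w' (by convert hw'U) hadj
      refine le_trans ?_ (h2.trans_eq (by congr!))
      rw [mul_assoc]
      exact mul_le_mul_of_nonneg_left h1 hp0
    · rw [degreeInto_insert hw, if_neg hadj, candidates_insert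
        (x := fun u => x u (g j)) (fun u hu => hU u hu j) hadj, add_zero]
      exact h1

end Embedding

/-! ### Counting the edges used so far. -/

section EdgesIn

variable {W : Type*} [Fintype W] (H : SimpleGraph W)

open scoped Classical in
/-- The number of edges of `H` with both ends in `U`. -/
noncomputable def edgesIn (U : Finset W) : ℕ := #{e ∈ H.edgeFinset | ∀ v ∈ e, v ∈ U}

lemma edgesIn_le (U : Finset W) : edgesIn H U ≤ H.edgeSet.ncard := by
  classical
  rw [Set.ncard_eq_toFinset_card']
  exact card_filter_le _ _

variable {H}

lemma edgesIn_pos {U : Finset W} {u w : W} (huw : H.Adj u w) (hu : u ∈ U) (hw : w ∈ U) :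
    1 ≤ edgesIn H U := by
  classical
  refine card_pos.2 ⟨s(u, w), ?_⟩
  simp [huw, hu, hw]

lemma edgesIn_add_degreeInto_le [DecidableEq W] {U : Finset W} {w : W} (hw : w ∉ U) :
    edgesIn H U + degreeInto H U w ≤ edgesIn H (insert w U) := by
  classical
  have hinj : degreeInto H U w = #({u ∈ U | H.Adj w u}.image fun u => s(w, u)) := by
    rw [card_image_of_injective _ fun a b h => Sym2.congr_right.1 h]
    rfl
  unfold edgesIn
  rw [hinj, ← card_union_of_disjoint]
  · refine card_le_card (union_subset ?_ ?_)
    · intro e he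
      simp only [mem_filter] at he ⊢
      exact ⟨he.1, fun v hv => mem_insert_of_mem (he.2 v hv)⟩
    · intro e he
      obtain ⟨u, hu, rfl⟩ := mem_image.1 he
      obtain ⟨hu, hadj⟩ := mem_filter.1 hu
      simp [hadj, hu]
  · rw [Finset.disjoint_left]
    intro e he he'
    obtain ⟨u, hu, rfl⟩ := mem_image.1 he'
    simp only [mem_filter] at he
    exact hw (he.2 w (by simp))

end EdgesIn

/-! ### Growing the blowup to all of `H`. -/

/-- Every factor of `D.descFactorial s` is at least `q * M`, so the ratio `M.choose s / D.choose s`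
is at most `q⁻¹ ^ s`. This is the source of the exponential size required of the parts. -/
lemma mul_choose_le_mul_choose {M D s : ℕ} {q a b : ℝ} (hq : 0 ≤ q) (hb : 0 ≤ b)
    (hs : s ≤ D) (hD : q * M + s ≤ D) (hab : a ≤ b * q ^ s) :
    a * M.choose s ≤ b * D.choose s := by
  have h1 : (M.choose s : ℝ) * s.factorial ≤ M ^ s := by
    have : M.choose s * s.factorial ≤ M ^ s := by
      rw [mul_comm, ← Nat.descFactorial_eq_factorial_mul_choose]
      exact Nat.descFactorial_le_pow M s
    exact_mod_cast this
  have h2 : (q * M) ^ s ≤ D.choose s * s.factorial := by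
    have h : (D + 1 - s) ^ s ≤ D.choose s * s.factorial := by
      rw [mul_comm, ← Nat.descFactorial_eq_factorial_mul_choose]
      exact Nat.pow_sub_le_descFactorial D s
    have h' : ((D + 1 - s : ℕ) : ℝ) ^ s ≤ D.choose s * s.factorial := by exact_mod_cast h
    refine le_trans (pow_le_pow_left₀ (by positivity) ?_ s) h'
    rw [Nat.cast_sub (by omega)]
    push_cast
    linarith
  have hf : (0 : ℝ) < s.factorial := by exact_mod_cast s.factorial_pos
  refine le_of_mul_le_mul_right ?_ hf
  rcases le_total a 0 with ha | ha
  · have : a * M.choose s * s.factorial ≤ 0 :=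
      mul_nonpos_of_nonpos_of_nonneg (mul_nonpos_of_nonpos_of_nonneg ha (by positivity)) hf.le
    exact this.trans (by positivity)
  calc a * M.choose s * s.factorial = a * (M.choose s * s.factorial) := by ring
    _ ≤ (b * q ^ s) * M ^ s := by gcongr
    _ = b * (q * M) ^ s := by ring
    _ ≤ b * (D.choose s * s.factorial) := by gcongr
    _ = _ := by ring

section Embedding

variable {Ω W : Type*} [Fintype W] {K : SimpleGraph Ω} {H : SimpleGraph W} {B : W → Finset Ω}
  {p ε : ℝ}

lemma IsPartialBlowup.exists_insert [DecidableEq W] (hε : 0 < ε) (hp0 : 0 ≤ p) (hp1 : p ≤ 1)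
    (hεp : ε ≤ p ^ Fintype.card W) (hB : ∀ w, (B w).Nonempty)
    (hreg : ∀ u w, H.Adj u w → LowerRegular ε p K (B u) (B w)) {U : Finset W} {m s D : ℕ}
    {x : W → Fin m → Ω} (hx : IsPartialBlowup K H B p U x) {w : W} (hw : w ∉ U)
    (hεd : (Fintype.card W + 1) * ε ≤ p ^ degreeInto H U w) (hsm : s ≤ m) (hm : 0 < m)
    (hD : (D : ℝ) < (p ^ degreeInto H U w - (Fintype.card W + 1) * ε) * m + 1)
    (hbig : s * m.choose s ≤ ε * #(B w) * D.choose s) :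
    ∃ x' : W → Fin s → Ω, IsPartialBlowup K H B p (insert w U) x' := by
  obtain ⟨S, Y, hS, hYS, hY⟩ := exists_large_common (ε := ε)
    (c := p ^ degreeInto H U w - Fintype.card W * ε) (B := B w) (s := s) (D := D)
    (fun j => goodCandidates K H B p U (fun u => x u j) w)
    (fun j => goodCandidates_subset _ _ _)
    (fun j => card_goodCandidates hε hp0 hp1 hεp hB hreg
      (fun w' hw' => hx.card_candidates w' hw' j) hw)
    (by linarith) hsm hm (by linarith)
  refine hx.extend hp0 hw hS ?_ hYS
  have h1 : (0 : ℝ) < m.choose s := by exact_mod_cast Nat.choose_pos hsm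
  have h2 : (s : ℝ) ≤ #Y := le_of_mul_le_mul_right (hbig.trans hY) h1
  exact_mod_cast h2

/-- Sets that are lower-regular along the edges of `H` contain a blowup of `H` of logarithmic
size. -/
lemma exists_isPartialBlowup_univ {p q ρ : ℝ} (H : SimpleGraph W) (hH : 1 ≤ H.edgeSet.ncard)
    (hq : 0 < q) (hq2 : q ≤ 1 / 2) (hqp : q < p) (hp1 : p ≤ 1) (hρ0 : 0 < ρ) (hρ1 : ρ < 1) :
    ∃ ε : ℝ, 0 < ε ∧ ε ≤ 1 ∧ ∀ {Ω : Type*} (K : SimpleGraph Ω) (B : W → Finset Ω),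
      (∀ u w, H.Adj u w → LowerRegular ε p K (B u) (B w)) →
      ∀ m₀ : ℕ, 0 < m₀ → (∀ w, m₀ ≤ ε * #(B w) * q ^ m₀) →
      ∃ (m : ℕ) (x : W → Fin m → Ω), IsPartialBlowup K H B p univ x ∧
        ρ ^ Fintype.card W * p ^ H.edgeSet.ncard * m₀ ≤ m * p := by
  classical
  obtain ⟨k, hk⟩ : ∃ k, k = Fintype.card W := ⟨_, rfl⟩
  have hp0 : 0 < p := hq.trans hqp
  -- Half of the gap `p - q`, times `M = L * m₀`, then pays for the extra `m₀` in `q * M + m₀ ≤ D`;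
  -- the other half absorbs the `ε` losses.
  obtain ⟨L, hL⟩ := exists_nat_gt (2 / (p - q))
  have hpq : 0 < p - q := by linarith
  have hL0 : (0 : ℝ) < L := lt_trans (by positivity) hL
  have hLpq : 1 ≤ (p - q) / 2 * L := by
    rw [div_lt_iff₀ hpq] at hL
    linarith
  have hρ' : 0 < 1 - ρ := by linarith
  obtain ⟨ε, hε0, hε⟩ : ∃ ε : ℝ, 0 < ε ∧
      (k + 1) * ε ≤ min ((1 - ρ) * p ^ k) (min ((p - q) / 2) (1 / 2)) ∧ L * ε ≤ 1 / 2 := by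
    refine ⟨min (min ((1 - ρ) * p ^ k) (min ((p - q) / 2) (1 / 2)) / (k + 1)) (1 / 2 / L),
      by positivity, ?_, ?_⟩
    · rw [← le_div_iff₀' (by positivity)]; exact min_le_left _ _
    · rw [← le_div_iff₀' hL0]; exact min_le_right _ _
  obtain ⟨hε1, hεL⟩ := hε
  obtain ⟨hεa, hεb, hεc⟩ : (k + 1) * ε ≤ (1 - ρ) * p ^ k ∧ (k + 1) * ε ≤ (p - q) / 2 ∧
      (k + 1) * ε ≤ 1 / 2 := by simpa using hε1
  have hkε : ε ≤ (k + 1) * ε := by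
    have : 0 ≤ (k : ℝ) * ε := by positivity
    linarith
  refine ⟨ε, hε0, by linarith, fun {Ω} K B hreg m₀ hm₀ hbig => ?_⟩
  have hεp : ε ≤ p ^ Fintype.card W := by
    rw [← hk]
    have : (1 - ρ) * p ^ k ≤ p ^ k := mul_le_of_le_one_left (by positivity) (by linarith)
    linarith
  have hm₀' : (0 : ℝ) < m₀ := by exact_mod_cast hm₀
  have hBpos : ∀ w, (0 : ℝ) < #(B w) := by
    intro w
    have h : 0 < ε * #(B w) * q ^ m₀ := hm₀'.trans_le (hbig w)
    exact pos_of_mul_pos_right (pos_of_mul_pos_left h (by positivity)) hε0.le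
  have hB : ∀ w, (B w).Nonempty := fun w => card_pos.1 (by exact_mod_cast hBpos w)
  have hbig1 : ∀ w, (m₀ : ℝ) ≤ ε * #(B w) := fun w =>
    (hbig w).trans (mul_le_of_le_one_right (by have := hBpos w; positivity)
      (pow_le_one₀ hq.le (by linarith)))
  -- As `q ≤ 1 / 2`, the size demanded by the first edge also covers the crude bound `2 ^ m₀` on
  -- binomial coefficients in all later steps.
  have hbig2 : ∀ w, (m₀ : ℝ) * 2 ^ m₀ ≤ ε * #(B w) := by
    intro w
    calc (m₀ : ℝ) * 2 ^ m₀ ≤ ε * #(B w) * q ^ m₀ * 2 ^ m₀ := by gcongr; exact hbig w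
      _ = ε * #(B w) * (q * 2) ^ m₀ := by rw [mul_pow]; ring
      _ ≤ ε * #(B w) := mul_le_of_le_one_right (by have := hBpos w; positivity)
        (pow_le_one₀ (by positivity) (by linarith))
  obtain ⟨e, he⟩ : H.edgeSet.Nonempty := (Set.ncard_pos (Set.toFinite _)).1 hH
  induction e using Sym2.ind with | _ w₁ w₂ => ?_
  have hadj : H.Adj w₁ w₂ := he
  obtain ⟨M, hM⟩ : ∃ M, M = L * m₀ := ⟨_, rfl⟩
  have hM' : (M : ℝ) = L * m₀ := by rw [hM]; push_cast; ring
  have hLn : 0 < L := by exact_mod_cast hL0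
  have hM0 : 0 < M := by rw [hM]; positivity
  -- Before anything is placed all transversals have the same candidates, so all `M` survive; the
  -- initial map is a dummy.
  obtain ⟨x₁, hx₁⟩ : ∃ x : W → Fin M → Ω, IsPartialBlowup K H B p {w₁} x := by
    have h0 : IsPartialBlowup K H B p ∅ (fun (_ : W) (_ : Fin M) => (hB w₁).choose) :=
      isPartialBlowup_empty _
    have hc := card_goodCandidates hε0 hp0.le hp1 hεp hB hreg
      (fun w' hw' => h0.card_candidates w' hw' ⟨0, hM0⟩) (notMem_empty w₁)
    refine h0.extend (Y := goodCandidates K H B p ∅ (fun _ => (hB w₁).choose) w₁) hp0.le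
      (notMem_empty w₁) (S := univ) (by simp) ?_ fun j _ => subset_rfl
    have : (M : ℝ) ≤ #(goodCandidates K H B p ∅ (fun _ => (hB w₁).choose) w₁) := by
      refine le_trans ?_ hc
      rw [← hk, hM', show degreeInto H ∅ w₁ = 0 by simp [degreeInto], pow_zero]
      have h1 := hbig1 w₁
      calc (L * m₀ : ℝ) ≤ L * (ε * #(B w₁)) := by gcongr
        _ = L * ε * #(B w₁) := by ring
        _ ≤ _ := by gcongr; linarith
    exact_mod_cast this
  have hw₂ : w₂ ∉ ({w₁} : Finset W) := by simpa using hadj.ne'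
  obtain ⟨x₂, hx₂⟩ : ∃ x : W → Fin m₀ → Ω, IsPartialBlowup K H B p (insert w₂ {w₁}) x := by
    have hd : degreeInto H {w₁} w₂ = 1 := by simp [degreeInto, filter_singleton, hadj.symm]
    have hD : q * M + m₀ ≤ (⌈(p - (k + 1) * ε) * M⌉₊ : ℝ) := by
      refine le_trans ?_ (Nat.le_ceil _)
      have h1 : (m₀ : ℝ) ≤ (p - q) / 2 * M := by
        rw [hM', ← mul_assoc]
        exact le_mul_of_one_le_left hm₀'.le hLpq
      have h2 : (q + (p - q) / 2) * (M : ℝ) ≤ (p - (k + 1) * ε) * M := by gcongr; linarith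
      linarith
    refine hx₁.exists_insert (D := ⌈(p - (k + 1) * ε) * M⌉₊) hε0 hp0.le hp1 hεp hB hreg hw₂
      ?_ ?_ hM0 ?_ ?_
    · rw [hd, ← hk]; linarith
    · rw [hM]; exact Nat.le_mul_of_pos_left _ hLn
    · rw [hd, ← hk, pow_one]
      exact Nat.ceil_lt_add_one (mul_nonneg (by linarith) (by positivity))
    · refine mul_choose_le_mul_choose hq.le (by have := hBpos w₂; positivity) ?_ hD (hbig w₂)
      have : (m₀ : ℝ) ≤ (⌈(p - (k + 1) * ε) * M⌉₊ : ℝ) := le_trans (by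
        have : 0 ≤ q * M := by positivity
        linarith) hD
      exact_mod_cast this
  -- The factor `p` on the right records the free edge `w₁w₂`, avoiding the exponent `edgesIn - 1`.
  have key : ∀ T : Finset W, ∃ (m : ℕ) (x : W → Fin m → Ω), 0 < m ∧ m ≤ m₀ ∧
      IsPartialBlowup K H B p (T ∪ (insert w₂ {w₁})) x ∧
      ρ ^ #T * p ^ edgesIn H (T ∪ (insert w₂ {w₁})) * m₀ ≤ m * p := by
    intro T
    induction T using Finset.induction_on with
    | empty =>
      refine ⟨m₀, x₂, hm₀, le_rfl, by simpa using hx₂, ?_⟩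
      rw [card_empty, pow_zero, one_mul, mul_comm (m₀ : ℝ)]
      gcongr
      refine (pow_le_pow_of_le_one hp0.le hp1 (edgesIn_pos hadj ?_ ?_)).trans_eq (pow_one p) <;>
        simp
    | insert w T hwT ih =>
      obtain ⟨m, x, hm, hmm₀, hx, hmp⟩ := ih
      rw [insert_union, card_insert_of_notMem hwT]
      set U := T ∪ (insert w₂ {w₁}) with hU
      by_cases hw : w ∈ U
      · rw [insert_eq_of_mem hw]
        refine ⟨m, x, hm, hmm₀, hx, le_trans ?_ hmp⟩
        gcongr ?_ * _ * _
        exact pow_le_pow_of_le_one hρ0.le hρ1.le (Nat.le_succ _)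
      have hm' : (0 : ℝ) < m := by exact_mod_cast hm
      obtain ⟨d, hd⟩ : ∃ d, d = degreeInto H U w := ⟨_, rfl⟩
      have hpd : p ^ k ≤ p ^ d := by
        rw [hd, hk]
        exact pow_le_pow_of_le_one hp0.le hp1 (degreeInto_le U w)
      have hpd1 : p ^ d ≤ 1 := pow_le_one₀ hp0.le hp1
      have hεd : ρ * p ^ d ≤ p ^ d - (k + 1) * ε := by
        have : (1 - ρ) * p ^ k ≤ (1 - ρ) * p ^ d := by gcongr
        linarith
      have hρd : 0 < ρ * p ^ d := by positivity
      obtain ⟨D, hDdef⟩ : ∃ D, D = ⌈(p ^ d - (k + 1) * ε) * m⌉₊ := ⟨_, rfl⟩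
      have hDge : ρ * p ^ d * m ≤ D := by
        rw [hDdef]
        refine le_trans ?_ (Nat.le_ceil _)
        gcongr
      have hD0 : 0 < D := by
        have : (0 : ℝ) < D := lt_of_lt_of_le (by positivity) hDge
        exact_mod_cast this
      have hDm : D ≤ m := by
        rw [hDdef]
        refine Nat.ceil_le.2 (mul_le_of_le_one_left hm'.le ?_)
        linarith
      -- With `s = D` the factor `D.choose s` is `1`: as many transversals as the multiplicity
      -- threshold allows are kept.
      obtain ⟨x', hx'⟩ := hx.exists_insert (s := D) (D := D) hε0 hp0.le hp1 hεp hB hreg hw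
        (by rw [← hd, ← hk]; linarith) hDm hm
        (by
          rw [← hd, ← hk, hDdef]
          exact Nat.ceil_lt_add_one (mul_nonneg (by linarith) hm'.le))
        (by
          rw [Nat.choose_self, Nat.cast_one, mul_one]
          refine le_trans ?_ (hbig2 w)
          have h1 : m.choose D ≤ 2 ^ m₀ :=
            (Nat.choose_le_two_pow m D).trans (Nat.pow_le_pow_right (by norm_num) hmm₀)
          have h2 : (m.choose D : ℝ) ≤ 2 ^ m₀ := by exact_mod_cast h1
          have h3 : (D : ℝ) ≤ m₀ := by exact_mod_cast hDm.trans hmm₀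
          gcongr)
      refine ⟨D, x', hD0, hDm.trans hmm₀, hx', ?_⟩
      have h1 : p ^ edgesIn H (insert w U) ≤ p ^ edgesIn H U * p ^ d := by
        rw [← pow_add, hd]
        exact pow_le_pow_of_le_one hp0.le hp1 (edgesIn_add_degreeInto_le hw)
      calc ρ ^ (#T + 1) * p ^ edgesIn H (insert w U) * m₀
          ≤ ρ ^ (#T + 1) * (p ^ edgesIn H U * p ^ d) * m₀ := by gcongr
        _ = ρ * p ^ d * (ρ ^ #T * p ^ edgesIn H U * m₀) := by ring
        _ ≤ ρ * p ^ d * (m * p) := by gcongr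
        _ = ρ * p ^ d * m * p := by ring
        _ ≤ D * p := by gcongr
  obtain ⟨m, x, -, -, hx, hmp⟩ := key univ
  rw [union_eq_left.2 (subset_univ _)] at hx hmp
  refine ⟨m, x, hx, le_trans ?_ hmp⟩
  rw [card_univ]
  gcongr ρ ^ _ * ?_ * _
  exact pow_le_pow_of_le_one hp0.le hp1 (edgesIn_le H univ)

end Embedding

/-! ### Choice of constants and the exponential bound. -/

/-- At `θ = 1` the expression equals `r ^ (e - 1) * log r`, so continuity allows some `θ < 1`. It is
the logarithm of the base obtained with `p = θ / r` and `q = θ ^ 2 / r`. -/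
lemma exists_parameter {r e : ℕ} (hr : 2 ≤ r) (k : ℕ) {c : ℝ}
    (hc : (r : ℝ) ^ (e - 1) * Real.log r < c) :
    ∃ θ : ℝ, 0 < θ ∧ θ < 1 ∧
      Real.log (r / θ ^ 2) / (θ ^ k * (θ / r) ^ (e - 1)) < c := by
  have hr0 : (r : ℝ) ≠ 0 := by positivity
  have hcont : ContinuousAt
      (fun θ : ℝ => Real.log (r / θ ^ 2) / (θ ^ k * (θ / r) ^ (e - 1))) 1 := by
    have h1 : ContinuousAt (fun θ : ℝ => (r : ℝ) / θ ^ 2) 1 :=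
      continuousAt_const.div (by fun_prop) (by norm_num)
    refine (h1.log (by simpa using hr0)).div (by fun_prop) ?_
    simp [hr0]
  have h1 : Real.log (r / 1 ^ 2) / (1 ^ k * (1 / (r : ℝ)) ^ (e - 1)) < c := by
    refine lt_of_eq_of_lt ?_ hc
    simp only [one_pow, div_one, one_mul, one_div, inv_pow, div_inv_eq_mul]
    ring
  have h2 := (hcont.eventually (gt_mem_nhds h1)).filter_mono
    (nhdsWithin_le_nhds (s := Set.Iio 1))
  obtain ⟨θ, hθ, hθ'⟩ := (h2.and (Ioo_mem_nhdsLT (zero_lt_one' ℝ))).exists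
  exact ⟨θ, hθ'.1, hθ'.2, hθ⟩

/-- The slack `q < q'` absorbs the linear factor `m`, because `m * (q / q') ^ m` is bounded. -/
lemma exists_le_mul_inv_pow {q q' c : ℝ} (hq : 0 < q) (hqq' : q < q') (hc : 0 < c) :
    ∃ C : ℝ, 0 < C ∧ ∀ (m n : ℕ), C * q⁻¹ ^ m ≤ n → (m : ℝ) ≤ c * n * q' ^ m := by
  have hq' : 0 < q' := hq.trans hqq'
  obtain ⟨C₁, hC₁⟩ := (tendsto_self_mul_const_pow_of_lt_one (r := q / q') (by positivity)
    ((div_lt_one hq').2 hqq')).bddAbove_range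
  refine ⟨max C₁ 1 / c, by positivity, fun m n h => ?_⟩
  have h1 : (m : ℝ) * (q / q') ^ m ≤ max C₁ 1 :=
    (hC₁ (Set.mem_range_self m)).trans (le_max_left _ _)
  have h2 : max C₁ 1 ≤ c * n * q ^ m := by
    calc max C₁ 1 = c * (max C₁ 1 / c * q⁻¹ ^ m) * q ^ m := by
          rw [inv_pow]; field_simp
      _ ≤ _ := by gcongr
  have h3 := h1.trans h2
  rw [div_pow, mul_div_assoc', div_le_iff₀ (by positivity)] at h3
  refine le_of_mul_le_mul_right (h3.trans_eq ?_) (by positivity : 0 < q ^ m)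
  ring

lemma canonicalArrow_of_isPartialBlowup {V : Type v} {W : Type u} [Fintype W] {r n t m : ℕ}
    {G : SimpleGraph V} {H : SimpleGraph W} {C : (blowup G n).EdgeLabeling (Fin r)} {i : Fin r}
    {f : Copy H G} {B : W → Finset (V × Fin n)} {p : ℝ} {x : W → Fin m → V × Fin n}
    (hx : IsPartialBlowup (C.labelGraph i) H B p univ x) (htm : t ≤ m)
    (hB : ∀ w, ∀ y ∈ B w, y.1 = f w) :
    ∃ (i : Fin r) (φ : Copy (blowup H t) (C.labelGraph i)) (f : Copy H G),
      ∀ x : W × Fin t, (φ x).1 = f x.1 := by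
  have hf : ∀ w j, (x w j).1 = f w := fun w j => hB w _ (hx.mem w (mem_univ w) j)
  refine ⟨i, ⟨⟨fun y => x y.1 (Fin.castLE htm y.2), ?_⟩, ?_⟩, f, fun y => hf _ _⟩
  · intro a b hab
    exact hx.adj _ (mem_univ _) _ (mem_univ _) hab _ _
  · rintro ⟨w, j⟩ ⟨w', j'⟩ h
    replace h : x w (Fin.castLE htm j) = x w' (Fin.castLE htm j') := h
    have hw : w = w' := f.injective ((hf w _).symm.trans ((congrArg Prod.fst h).trans (hf w' _)))
    subst hw
    have := hx.injective w (mem_univ w) h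
    rw [Fin.castLE_inj] at this
    rw [this]

lemma exists_canonicalArrow_le_of_pos {V : Type v} [Finite V] {W : Type u} [Finite W] {r : ℕ}
    (hr : 2 ≤ r) {G : SimpleGraph V} {H : SimpleGraph W} (hGH : Arrow r G H)
    (hH : 1 ≤ H.edgeSet.ncard) {b : ℝ} (hb0 : 0 < b)
    (hb : (r : ℝ) ^ (H.edgeSet.ncard - 1) * Real.log r < Real.log b) :
    ∃ a : ℝ, 0 < a ∧ ∀ t : ℕ, ∃ n : ℕ, CanonicalArrow r G n H t ∧ (n : ℝ) ≤ a * b ^ t := by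
  classical
  have := Fintype.ofFinite W
  obtain ⟨e, he⟩ : ∃ e, e = H.edgeSet.ncard := ⟨_, rfl⟩
  rw [← he] at hb hH
  obtain ⟨θ, hθ0, hθ1, hθ⟩ := exists_parameter hr (Fintype.card W) hb
  have hr2 : (2 : ℝ) ≤ r := by exact_mod_cast hr
  have hr0 : (0 : ℝ) < r := by linarith
  obtain ⟨p, hp⟩ : ∃ p, p = θ / r := ⟨_, rfl⟩
  obtain ⟨q, hq⟩ : ∃ q, q = θ ^ 2 / r := ⟨_, rfl⟩
  have hq0 : 0 < q := by rw [hq]; positivity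
  have hqp : q < p := by
    rw [hq, hp]
    exact div_lt_div_of_pos_right (by nlinarith) hr0
  have hpr : p < 1 / r := by rw [hp]; exact div_lt_div_of_pos_right hθ1 hr0
  have hr12 : (1 / r : ℝ) ≤ 1 / 2 := one_div_le_one_div_of_le two_pos hr2
  -- The midpoint of `q` and `p` leaves room on both sides: below `p` for the embedding, above `q`
  -- to absorb the factor `m₀`.
  obtain ⟨ε, hε0, hε1, hemb⟩ := exists_isPartialBlowup_univ (p := p) (q := (p + q) / 2) H
    (he ▸ hH) (by linarith) (by linarith) (by linarith) (by linarith) hθ0 hθ1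
  obtain ⟨δ, hδ0, -, hreg⟩ := exists_lowerRegular_copy (p := p) (ε := ε) (by omega) hGH
    (by linarith) hpr hε0 hε1
  obtain ⟨C, hC0, hC⟩ := exists_le_mul_inv_pow (q := q) (q' := (p + q) / 2) (c := ε * δ) hq0
    (by linarith) (by positivity)
  obtain ⟨β, hβ⟩ : ∃ β, β = θ ^ Fintype.card W * p ^ (e - 1) := ⟨_, rfl⟩
  have hp0 : 0 < p := hq0.trans hqp
  have hβ0 : 0 < β := by rw [hβ]; positivity
  have hq1 : 1 ≤ q⁻¹ := (one_le_inv₀ hq0).2 (by linarith)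
  have hqb : q⁻¹ ^ (1 / β) ≤ b := by
    rw [← Real.log_le_log_iff (by positivity) hb0, Real.log_rpow (by positivity)]
    refine le_trans (le_of_eq ?_) hθ.le
    rw [← hp, ← hβ, hq, inv_div]
    ring
  refine ⟨(C + 1) * q⁻¹ ^ 2, by positivity, fun t => ?_⟩
  -- The embedding yields at least `β * m₀` transversals, hence at least `t`; the added `1` keeps
  -- `m₀` positive when `t = 0`.
  obtain ⟨m₀, hm₀⟩ : ∃ m₀, m₀ = ⌈(t : ℝ) / β⌉₊ + 1 := ⟨_, rfl⟩
  obtain ⟨n, hn⟩ : ∃ n, n = ⌈C * q⁻¹ ^ m₀⌉₊ := ⟨_, rfl⟩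
  have hnC : C * q⁻¹ ^ m₀ ≤ n := hn ▸ Nat.le_ceil _
  have hn0 : 0 < n := by
    have : (0 : ℝ) < n := lt_of_lt_of_le (by positivity) hnC
    exact_mod_cast this
  refine ⟨n, fun col => ?_, ?_⟩
  · obtain ⟨A, i, f, hA, hAc, hAreg⟩ := hreg (Ω := V × Fin n) (fun i => col.labelGraph i)
      (fun v => {v} ×ˢ univ) (fun v => ⟨(v, ⟨0, hn0⟩), by simp⟩) (by
        intro v w hvw x hx y hy
        have hxy : (blowup G n).Adj x y := by
          simp only [mem_product, mem_singleton, mem_univ, and_true] at hx hy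
          change G.Adj x.1 y.1
          rwa [hx, hy]
        exact ⟨_, (EdgeLabeling.labelGraph_adj x y).2 ⟨hxy, rfl⟩⟩)
    obtain ⟨m, x, hx, hm⟩ := hemb (col.labelGraph i) (fun w => A (f w)) hAreg m₀ (by omega)
      fun w => by
        refine (hC m₀ n hnC).trans ?_
        have := hAc (f w)
        rw [card_product, card_singleton, card_univ, Fintype.card_fin, one_mul] at this
        rw [mul_assoc ε]
        gcongr
    refine canonicalArrow_of_isPartialBlowup hx ?_ (f := f) fun w y hy => ?_
    · have h1 : β * m₀ ≤ m := by
        refine le_of_mul_le_mul_right (le_trans (le_of_eq ?_) hm) hp0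
        rw [hβ, ← he]
        obtain ⟨e, rfl⟩ : ∃ e', e = e' + 1 := ⟨e - 1, by omega⟩
        rw [Nat.add_sub_cancel, pow_succ]
        ring
      have h2 : (t : ℝ) / β ≤ m₀ := by
        rw [hm₀]
        push_cast
        exact (Nat.le_ceil _).trans (by linarith)
      rw [div_le_iff₀' hβ0] at h2
      exact_mod_cast h2.trans h1
    · have := hA (f w) hy
      rw [mem_product, mem_singleton] at this
      exact this.1
  · have h1 : (m₀ : ℝ) ≤ t / β + 2 := by
      have := Nat.ceil_lt_add_one (by positivity : 0 ≤ (t : ℝ) / β)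
      rw [hm₀]
      push_cast
      linarith
    have h2 : q⁻¹ ^ m₀ ≤ q⁻¹ ^ 2 * b ^ t := by
      calc q⁻¹ ^ m₀ = q⁻¹ ^ (m₀ : ℝ) := (Real.rpow_natCast _ _).symm
        _ ≤ q⁻¹ ^ ((t : ℝ) / β + 2) := Real.rpow_le_rpow_of_exponent_le hq1 h1
        _ = q⁻¹ ^ 2 * (q⁻¹ ^ (1 / β)) ^ t := by
          rw [Real.rpow_add (by positivity), ← Real.rpow_natCast (q⁻¹ ^ (1 / β)),
            ← Real.rpow_mul (by positivity), mul_comm, Real.rpow_two]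
          congr 2
          ring
        _ ≤ _ := by gcongr
    have h3 : (n : ℝ) ≤ C * q⁻¹ ^ m₀ + 1 := by
      rw [hn]
      exact (Nat.ceil_lt_add_one (by positivity)).le
    have h4 : 1 ≤ q⁻¹ ^ m₀ := one_le_pow₀ hq1
    calc (n : ℝ) ≤ (C + 1) * q⁻¹ ^ m₀ := by linarith
      _ ≤ (C + 1) * (q⁻¹ ^ 2 * b ^ t) := by gcongr
      _ = _ := by ring

lemma canonicalArrow_of_edgeSet_empty {V : Type v} {W : Type u} {r : ℕ} (hr : 0 < r)
    {G : SimpleGraph V} {H : SimpleGraph W} (hGH : Arrow r G H) (hH : H.edgeSet = ∅) (t : ℕ) :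
    CanonicalArrow r G t H t := by
  intro C
  obtain ⟨i, ⟨g⟩⟩ := hGH fun _ => ⟨0, hr⟩
  refine ⟨⟨0, hr⟩, ⟨⟨fun y => (g y.1, y.2), ?_⟩, ?_⟩,
    ⟨(Hom.ofLE (EdgeLabeling.labelGraph_le _)).comp g.toHom, g.injective'⟩, fun _ => rfl⟩
  · intro a b hab
    have h : s(a.1, b.1) ∈ H.edgeSet := hab
    simp [hH] at h
  · rintro ⟨w, j⟩ ⟨w', j'⟩ h
    obtain ⟨h1, h2⟩ := Prod.ext_iff.1 h
    exact Prod.ext (g.injective h1) h2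

/-- A witness `n` is provided, not only a bound on the infimum: `sInf ∅ = 0` would make a bound on
`blowupRamseyNumber` silent about finiteness. -/
lemma exists_canonicalArrow_le {V : Type v} [Finite V] {W : Type u} [Finite W] {r : ℕ}
    (hr : 2 ≤ r) {G : SimpleGraph V} {H : SimpleGraph W} (hGH : Arrow r G H) {b : ℝ} (hb1 : 1 < b)
    (hb : 1 ≤ H.edgeSet.ncard →
      (r : ℝ) ^ (H.edgeSet.ncard - 1) * Real.log r < Real.log b) :
    ∃ a : ℝ, 0 < a ∧ ∀ t : ℕ, ∃ n : ℕ, CanonicalArrow r G n H t ∧ (n : ℝ) ≤ a * b ^ t := by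
  rcases Nat.eq_zero_or_pos H.edgeSet.ncard with h0 | hpos
  · have hb' : 0 < b - 1 := by linarith
    refine ⟨(b - 1)⁻¹, by positivity, fun t => ⟨t, canonicalArrow_of_edgeSet_empty (by omega) hGH
      ((Set.ncard_eq_zero (Set.toFinite _)).1 h0) t, ?_⟩⟩
    -- Without edges `n = t` suffices, and Bernoulli's inequality bounds `t` by `b ^ t / (b - 1)`.
    have := one_add_mul_sub_le_pow (by linarith : -1 ≤ b) t
    rw [← div_eq_inv_mul, le_div_iff₀ hb']
    linarith
  · exact exists_canonicalArrow_le_of_pos hr hGH hpos (by linarith) (hb hpos)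

lemma exists_blowupRamseyNumber_le {V : Type v} [Finite V] {W : Type u} [Finite W] {r : ℕ}
    (hr : 2 ≤ r) {G : SimpleGraph V} {H : SimpleGraph W} (hGH : Arrow r G H) {b : ℝ} (hb1 : 1 < b)
    (hb : 1 ≤ H.edgeSet.ncard →
      (r : ℝ) ^ (H.edgeSet.ncard - 1) * Real.log r < Real.log b) :
    ∃ a₀ : ℝ, ∀ a : ℝ, a₀ ≤ a → ∀ t : ℕ, (blowupRamseyNumber r G H t : ℝ) ≤ a * b ^ t := by
  obtain ⟨a₀, -, h⟩ := exists_canonicalArrow_le hr hGH hb1 hb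
  refine ⟨a₀, fun a ha t => ?_⟩
  obtain ⟨n, hn, hle⟩ := h t
  have h1 : (blowupRamseyNumber r G H t : ℝ) ≤ n := by exact_mod_cast Nat.sInf_le hn
  refine h1.trans (hle.trans ?_)
  gcongr

end BlowupRamsey

/-! ### The two bounds. -/

theorem mainTheorem1 (r : ℕ) (hr : 2 ≤ r) :
    (∀ (W : Type u) [Finite W] (H : SimpleGraph W),
      ∃ b : ℝ, 0 < b ∧
        ∀ (V : Type v) [Finite V] (G : SimpleGraph V), BlowupRamsey.Arrow r G H →
          ∃ a : ℝ, 0 < a ∧ ∀ t : ℕ,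
            (∃ n : ℕ, BlowupRamsey.CanonicalArrow r G n H t) ∧
            (BlowupRamsey.blowupRamseyNumber r G H t : ℝ) ≤ a * b ^ t) ∧
    (∃ γ₀ : ℝ, 0 < γ₀ ∧ ∀ γ : ℝ, 0 < γ → γ < γ₀ →
      ∀ (W : Type u) [Finite W] (H : SimpleGraph W)
        (V : Type v) [Finite V] (G : SimpleGraph V), BlowupRamsey.Arrow r G H →
        ∃ a₀ : ℝ, ∀ a : ℝ, a₀ ≤ a → ∀ t : ℕ,
          (H.edgeSet.ncard ≠ 1 →
            (BlowupRamsey.blowupRamseyNumber r G H t : ℝ) ≤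
              a * ((r : ℝ) ^ (((r : ℝ) + γ) ^ ((H.edgeSet.ncard : ℝ) - 1))) ^ t) ∧
          (H.edgeSet.ncard = 1 →
            (BlowupRamsey.blowupRamseyNumber r G H t : ℝ) ≤
              a * ((r : ℝ) ^ (1 + γ)) ^ t)) := by
  have hr1 : (1 : ℝ) < r := by exact_mod_cast hr
  have hr0 : (0 : ℝ) < r := by linarith
  have hlog : 0 < Real.log r := Real.log_pos hr1
  refine ⟨fun W _ H => ?_, 1, one_pos, fun γ hγ _ W _ H V _ G hGH => ?_⟩
  · refine ⟨(r : ℝ) ^ (r ^ H.edgeSet.ncard), by positivity, fun V _ G hGH => ?_⟩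
    obtain ⟨a, ha, h⟩ := BlowupRamsey.exists_canonicalArrow_le hr hGH
      (b := (r : ℝ) ^ (r ^ H.edgeSet.ncard)) (one_lt_pow₀ hr1 (by positivity)) fun hH => by
        rw [Real.log_pow]
        push_cast
        gcongr
        omega
    refine ⟨a, ha, fun t => ?_⟩
    obtain ⟨n, hn, hle⟩ := h t
    refine ⟨⟨n, hn⟩, le_trans ?_ hle⟩
    exact_mod_cast Nat.sInf_le hn
  · by_cases h1 : H.edgeSet.ncard = 1
    · obtain ⟨a₀, h⟩ := BlowupRamsey.exists_blowupRamseyNumber_le hr hGH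
        (b := (r : ℝ) ^ (1 + γ)) (Real.one_lt_rpow hr1 (by linarith)) fun _ => by
          rw [Real.log_rpow hr0, h1]
          gcongr
          simpa using hγ
      exact ⟨a₀, fun a ha t => ⟨fun h' => absurd h1 h', fun _ => h a ha t⟩⟩
    -- If `H` has no edges the real exponent is `-1`, and only `b > 1` matters. With at least two
    -- edges, `γ > 0` makes `(r + γ) ^ (e - 1)` strictly larger than `r ^ (e - 1)`.
    · obtain ⟨a₀, h⟩ := BlowupRamsey.exists_blowupRamseyNumber_le hr hGH
        (b := (r : ℝ) ^ (((r : ℝ) + γ) ^ ((H.edgeSet.ncard : ℝ) - 1)))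
        (Real.one_lt_rpow hr1 (by positivity)) fun hH => by
          rw [Real.log_rpow hr0, ← Nat.cast_pred hH, Real.rpow_natCast]
          gcongr
          · omega
          · linarith
      exact ⟨a₀, fun a ha t => ⟨fun _ => h a ha t, fun h' => absurd h' h1⟩⟩
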